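/- Let $\Omega$ be a set and let $G\leqslant\operatorname{Sym}(\Omega)$ be a finite transitive permutation group on $\Omega$. Denote by $d(G)$ the minimum number of generators of $G$, and by $\operatorname{Aut}_{\mathrm{perm}}(G)\leqslant\operatorname{Aut}(G)$ the group of all automorphisms of $G$ that are induced through conjugation by some element of the normaliser $\operatorname{N}_{\operatorname{Sym}(\Omega)}(G)$. For integers $d\geqslant 0$ and $n\geqslant 1$, set \[ \mathfrak{f}(d,n):=16^{(n+1)d}\cdot n^{2n^3d^2(5+d+4n^3\log_2 n)+2n^3+4nd+4d}. \] Then \[ |G|\leqslant\mathfrak{f}\bigl(d(G),|\operatorname{Aut}_{\mathrm{perm}}(G)|\bigr). \] -/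

import Mathlib

namespace Equiv.Perm

/-- `Aut_perm(G)`: the automorphisms of the permutation group `G ≤ Sym(Ω)` that are induced
through conjugation by an element of the normaliser of `G` in `Sym(Ω)`, as a subgroup of
`Aut(G)`. -/
def autPerm {Ω : Type*} (G : Subgroup (Equiv.Perm Ω)) : Subgroup (MulAut G) :=
  G.normalizerMonoidHom.range

end Equiv.Perm

/-- The function
`𝔣(d, n) = 16 ^ ((n+1)d) * n ^ (2n³d²(5 + d + 4n³ log₂ n) + 2n³ + 4nd + 4d)`.
The second exponent is a real number because of the logarithm, so the value is taken in `ℝ`. -/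
noncomputable def orderBound (d n : ℕ) : ℝ :=
  (16 : ℝ) ^ ((n + 1) * d) *
    (n : ℝ) ^ (2 * (n : ℝ) ^ 3 * (d : ℝ) ^ 2 * (5 + (d : ℝ) + 4 * (n : ℝ) ^ 3 * Real.logb 2 n)
      + 2 * (n : ℝ) ^ 3 + 4 * (n : ℝ) * (d : ℝ) + 4 * (d : ℝ))

open Subgroup
open scoped commutatorElement

/-! Let n = |Aut_perm(G)|, H a point stabiliser and m = |G : Z(G)|. Inner automorphisms lie in
Aut_perm(G), so m ≤ n, and Schur's theorem bounds |G'|. By transitivity H ∩ Z(G) = 1, so |H| ≤ m. It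
remains to bound the exponent e of the abelian quotient B = G/G'H, which needs at most d(G)
generators. Every automorphism fixing H pointwise lies in Aut_perm(G)
(`mem_autPerm_of_fixes_stabilizer`). Homomorphisms φ : G → B → Z(G) give such automorphisms g ↦ g
φ(g), and `exponent_le_of_forall_mem_of_fixes` finds at least `q.totient` of them for some q with e
∣ mq. As q is at most twice the square of its totient, e ≤ 2n³. -/

/-! ### Totients and units congruent to 1. -/

/-- An odd number is at most the square of its totient. -/
theorem Nat.le_totient_sq_of_odd {q : ℕ} (hq : Odd q) : q ≤ q.totient ^ 2 := by
  induction q using Nat.recOnPosPrimePosCoprime with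
  | zero => simp
  | one => simp
  | prime_pow p k hp hk =>
    obtain ⟨j, rfl⟩ : ∃ j, k = j + 1 := ⟨k - 1, by omega⟩
    have hp2 : p ≠ 2 := by
      rintro rfl
      exact (Nat.not_odd_iff_even.2 ((even_two).pow_of_ne_zero (by omega))) hq
    -- The inequality p ≤ (p - 1)² needs p ≥ 3.
    obtain ⟨r, rfl⟩ : ∃ r, p = r + 3 := ⟨p - 3, by have := hp.two_le; omega⟩
    rw [Nat.totient_prime_pow_succ hp, pow_succ, mul_pow]
    refine Nat.mul_le_mul (Nat.le_self_pow two_ne_zero _) ?_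
    have : r + 3 - 1 = r + 2 := by omega
    rw [this]
    nlinarith
  | coprime a b _ _ hab iha ihb =>
    rw [Nat.odd_mul] at hq
    rw [Nat.totient_mul hab, mul_pow]
    exact Nat.mul_le_mul (iha hq.1) (ihb hq.2)

/-- The totient grows at least like the square root. -/
theorem Nat.le_two_mul_totient_sq (q : ℕ) : q ≤ 2 * q.totient ^ 2 := by
  rcases Nat.eq_zero_or_pos q with rfl | hq
  · simp
  obtain ⟨k, r, hr, rfl⟩ := Nat.exists_eq_two_pow_mul_odd hq.ne'
  have h := Nat.le_totient_sq_of_odd hr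
  rcases k with _ | j
  · simp only [pow_zero, one_mul]
    omega
  · rw [Nat.totient_mul (Nat.Coprime.pow_left _ (Nat.coprime_two_left.2 hr)),
      Nat.totient_prime_pow_succ Nat.prime_two, mul_pow]
    calc 2 ^ (j + 1) * r = 2 * (2 ^ j * r) := by ring
      _ ≤ 2 * ((2 ^ j * (2 - 1)) ^ 2 * r.totient ^ 2) := by
        refine Nat.mul_le_mul_left _ (Nat.mul_le_mul ?_ h)
        simpa only [Nat.add_one_sub_one, mul_one] using Nat.le_self_pow two_ne_zero (2 ^ j)

/-- There are at least `φ q` residues modulo `D * q` that are units congruent to `1` modulo `D`. -/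
theorem ZMod.totient_le_card_ker_unitsMap {D q : ℕ} (hD : D ≠ 0) (hq : q ≠ 0) :
    q.totient ≤ Nat.card (ZMod.unitsMap (Dvd.intro q rfl : D ∣ D * q)).ker := by
  have : NeZero (D * q) := ⟨mul_ne_zero hD hq⟩
  have : NeZero D := ⟨hD⟩
  set f := ZMod.unitsMap (Dvd.intro q rfl : D ∣ D * q)
  have hcard : Nat.card f.ker * D.totient = (D * q).totient := by
    rw [← ZMod.card_units_eq_totient, ← ZMod.card_units_eq_totient, ← Nat.card_eq_fintype_card,
      ← Nat.card_eq_fintype_card, ← f.ker.card_mul_index, Subgroup.index_ker,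
      MonoidHom.range_eq_top.2 (ZMod.unitsMap_surjective _), Subgroup.card_top]
  have h := Nat.totient_super_multiplicative D q
  rw [← hcard, mul_comm] at h
  exact Nat.le_of_mul_le_mul_right h (Nat.totient_pos.2 (Nat.pos_of_ne_zero hD))

/-! ### Central automorphisms and the exponent. -/

/-- An element of maximal order in a finite abelian group can be sent to any element of suitable
order by a homomorphism with cyclic image. -/
theorem CommGroup.exists_monoidHom_apply_eq {B A : Type*} [CommGroup B] [Finite B] [Group A]
    {x : B} (hx : orderOf x = Monoid.exponent B) {y : A} (hy : orderOf y ∣ Monoid.exponent B) :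
    ∃ φ : B →* A, φ x = y ∧ ∀ b, φ b ∈ zpowers y := by
  have : NeZero (Monoid.exponent B) := ⟨Monoid.exponent_ne_zero_of_finite⟩
  set e := Monoid.exponent B with he
  obtain ⟨ζ₀, hζ₀⟩ := HasEnoughRootsOfUnity.exists_primitiveRoot ℂ e
  obtain ⟨ζ, rfl⟩ := hζ₀.isUnit (NeZero.ne e)
  have hζ : IsPrimitiveRoot ζ e := IsPrimitiveRoot.coe_units_iff.1 hζ₀
  have hgen : ∀ w : zpowers x, w ∈ zpowers (⟨x, mem_zpowers x⟩ : zpowers x) := by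
    rintro ⟨_, k, rfl⟩
    exact ⟨k, by ext; simp⟩
  have hgen' : ∀ w : zpowers ζ, w ∈ zpowers (⟨ζ, mem_zpowers ζ⟩ : zpowers ζ) := by
    rintro ⟨_, k, rfl⟩
    exact ⟨k, by ext; simp⟩
  have hordζ : orderOf ζ = e := hζ.eq_orderOf.symm
  -- The character x ↦ ζ of ⟨x⟩ extends to B. Its values are e-th roots of unity, hence lie in ⟨ζ⟩,
  -- from which ζ ↦ y is well defined.
  obtain ⟨χ, hχ⟩ := MonoidHom.domRestrict_surjective (M := ℂ) (zpowers x)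
    (monoidHomOfForallMemZpowers (g' := ζ) hgen (by rw [Subgroup.orderOf_mk, hordζ, hx]))
  have hχx : χ x = ζ := by
    have := DFunLike.congr_fun hχ ⟨x, mem_zpowers x⟩
    rwa [monoidHomOfForallMemZpowers_apply_gen] at this
  have hχmem : ∀ b, χ b ∈ zpowers ζ := fun b => by
    rw [hζ.zpowers_eq, mem_rootsOfUnity, ← map_pow, he, Monoid.pow_exponent_eq_one, map_one]
  set ψ : zpowers ζ →* A :=
    monoidHomOfForallMemZpowers (g' := y) hgen' (by rwa [Subgroup.orderOf_mk, hordζ]) with hψ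
  have hψζ : ψ ⟨ζ, mem_zpowers ζ⟩ = y := monoidHomOfForallMemZpowers_apply_gen _ _
  refine ⟨ψ.comp (χ.codRestrict _ hχmem), ?_, fun b => ?_⟩
  · rw [← hψζ]
    simp only [MonoidHom.comp_apply]
    congr 1
    exact Subtype.ext hχx
  · obtain ⟨k, hk⟩ := hgen' (χ.codRestrict _ hχmem b)
    refine ⟨k, ?_⟩
    simp only [MonoidHom.comp_apply, ← hk, map_zpow, hψζ]

/-- The automorphism `g ↦ g * φ g` attached to a homomorphism `φ` into the centre. -/
noncomputable def MulAut.ofCentralHom {G : Type*} [Group G] [Finite G] (φ : G →* G)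
    (hφ : ∀ g, φ g ∈ center G) (hinj : ∀ g, g * φ g = 1 → g = 1) : MulAut G :=
  MulEquiv.ofBijective
    (MonoidHom.mk' (fun g => g * φ g) fun a b => by
      have := mem_center_iff.1 (hφ a) b
      rw [map_mul, mul_assoc, mul_assoc, ← mul_assoc b, this, mul_assoc])
    (Finite.injective_iff_bijective.1 ((injective_iff_map_eq_one _).2 hinj))

@[simp]
theorem MulAut.ofCentralHom_apply {G : Type*} [Group G] [Finite G] (φ : G →* G)
    (hφ : ∀ g, φ g ∈ center G) (hinj : ∀ g, g * φ g = 1 → g = 1) (g : G) :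
    MulAut.ofCentralHom φ hφ hinj g = g * φ g := rfl

/-- A finite group has many automorphisms fixing a subgroup `H` pointwise as soon as the largest
abelian quotient in which `H` dies has large exponent. -/
theorem exponent_le_of_forall_mem_of_fixes {G : Type*} [Group G] [Finite G] (H : Subgroup G)
    (A : Subgroup (MulAut G)) (hA : ∀ α : MulAut G, (∀ h ∈ H, α h = h) → α ∈ A) :
    Monoid.exponent (Abelianization G ⧸ H.map Abelianization.of) ≤
      (center G).index * (2 * Nat.card A ^ 2) := by
  set B := Abelianization G ⧸ H.map Abelianization.of with hB
  set m := (center G).index with hm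
  let π : G →* B := (QuotientGroup.mk' (H.map Abelianization.of)).comp Abelianization.of
  have hπ : Function.Surjective π :=
    (QuotientGroup.mk'_surjective _).comp QuotientGroup.mk_surjective
  have hπH : ∀ h ∈ H, π h = 1 := fun h hh =>
    (QuotientGroup.eq_one_iff _).2 (mem_map_of_mem _ hh)
  have : Finite (Abelianization G) := Finite.of_surjective _ QuotientGroup.mk_surjective
  have : Finite B := Finite.of_surjective π hπ
  obtain ⟨b, hb⟩ := Monoid.exists_orderOf_eq_exponent (Monoid.ExponentExists.of_finite (G := B))
  obtain ⟨x, rfl⟩ := hπ b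
  set e := Monoid.exponent B with he
  have he0 : e ≠ 0 := Monoid.exponent_ne_zero_of_finite
  have hm0 : m ≠ 0 := FiniteIndex.index_ne_zero
  -- The m-th power of x is central. Its order N satisfies e ∣ mN, so e ∣ mq for q = gcd(e, N).
  set z := x ^ m with hz
  have hzc : z ∈ center G := (center G).pow_index_mem x
  set N := orderOf z with hN
  have hN0 : N ≠ 0 := (orderOf_pos z).ne'
  set q := Nat.gcd e N with hq
  have hq0 : q ≠ 0 := (Nat.gcd_pos_of_pos_left _ (Nat.pos_of_ne_zero he0)).ne'
  have hqe : q ∣ e := Nat.gcd_dvd_left e N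
  obtain ⟨u, hu⟩ : q ∣ N := Nat.gcd_dvd_right e N
  have hu0 : u ≠ 0 := by rintro rfl; exact hN0 (by simpa using hu)
  have hemq : e ∣ m * q := by
    rw [hq, ← Nat.gcd_mul_left]
    refine Nat.dvd_gcd (dvd_mul_left _ _) ?_
    rw [← hb, orderOf_dvd_iff_pow_eq_one, ← map_pow, pow_mul, ← hz, hN, pow_orderOf_eq_one, map_one]
  clear_value q
  -- With N = qu, the order of z^u is q, which divides e, so x ↦ z^(uk) defines a φ. Then z φ(z) =
  -- z^(1 + Dk), which is why units congruent to 1 modulo D, taken modulo Dq = mN, parametrise the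
  -- automorphisms.
  set D := u * m with hD
  have hD0 : D ≠ 0 := mul_ne_zero hu0 hm0
  have : NeZero (D * q) := ⟨mul_ne_zero hD0 hq0⟩
  set K := (ZMod.unitsMap (Dvd.intro q rfl : D ∣ D * q)).ker with hK
  have hk : ∀ v : K, ∃ k : ℤ, (((v : (ZMod (D * q))ˣ) : ZMod (D * q)).val : ℤ) = 1 + D * k := by
    rintro ⟨v, hv⟩
    have h1 : ((v : ZMod (D * q)).cast : ZMod D) = 1 := by
      rw [← ZMod.unitsMap_val (Dvd.intro q rfl), MonoidHom.mem_ker.1 hv, Units.val_one]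
    rw [ZMod.cast_eq_val] at h1
    have h2 : (((v : ZMod (D * q)).val - 1 : ℤ) : ZMod D) = 0 := by
      push_cast
      rw [h1, sub_self]
    obtain ⟨k, hk⟩ := (ZMod.intCast_zmod_eq_zero_iff_dvd _ _).1 h2
    exact ⟨k, by simp only; linarith⟩
  choose k hk using hk
  have hα : ∀ v : K, ∃ α ∈ A, α x = x * z ^ (u * k v : ℤ) := by
    intro v
    have hord : orderOf (z ^ (u * k v : ℤ)) ∣ e := by
      refine dvd_trans ?_ hqe
      rw [← Int.natCast_dvd_natCast, orderOf_dvd_iff_zpow_eq_one, ← zpow_mul, ← orderOf_dvd_iff_zpow_eq_one, ← hN, hu]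
      exact ⟨k v, by push_cast; ring⟩
    obtain ⟨ψ, hψx, hψ⟩ := CommGroup.exists_monoidHom_apply_eq hb hord
    have hzp : ∀ g, ψ (π g) ∈ zpowers z := fun g =>
      zpowers_le.2 (zpow_mem (mem_zpowers z) _) (hψ (π g))
    refine ⟨MulAut.ofCentralHom (ψ.comp π) (fun g => zpowers_le.2 hzc (hzp g)) ?_, ?_, ?_⟩
    · intro g hg
      -- A kernel element is the inverse of its image under φ, so injectivity need only be checked
      -- on ⟨z⟩, where the map is the power 1 + Dk, prime to N.
      obtain ⟨j, hj⟩ : g ∈ zpowers z := by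
        rw [eq_inv_of_mul_eq_one_left hg]
        exact inv_mem (hzp g)
      simp only at hj
      have hz' : ψ (π z) = z ^ (u * k v * m : ℤ) := by
        rw [hz, map_pow, map_pow, hψx, zpow_mul _ _ (m : ℤ), zpow_natCast]
      have hcop : IsCoprime (N : ℤ) (1 + D * k v) := by
        rw [← hk v, Nat.isCoprime_iff_coprime, hu]
        refine Nat.Coprime.coprime_dvd_left ⟨m, ?_⟩ (ZMod.val_coe_unit_coprime _).symm
        rw [hD]; ring
      rw [← hj, MonoidHom.comp_apply, map_zpow, map_zpow, hz', ← zpow_mul, ← zpow_add,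
        ← orderOf_dvd_iff_zpow_eq_one, ← hN] at hg
      have : (N : ℤ) ∣ (1 + D * k v) * j := by
        convert hg using 1
        rw [hD]; push_cast; ring
      rw [← hj, ← orderOf_dvd_iff_zpow_eq_one]
      exact hcop.dvd_of_dvd_mul_left this
    · refine hA _ fun h hh => ?_
      simp [hπH h hh]
    · simp [hψx]
  choose α hαA hαx using hα
  have hinj : Function.Injective fun v : K => (⟨α v, hαA v⟩ : A) := by
    intro v w hvw
    have h1 : α v = α w := congrArg Subtype.val hvw
    have h2 : z ^ (u * k v : ℤ) = z ^ (u * k w : ℤ) := by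
      have := DFunLike.congr_fun h1 x
      rw [hαx, hαx] at this
      exact mul_left_cancel this
    rw [zpow_eq_zpow_iff_modEq, ← hN, hu] at h2
    obtain ⟨t, ht⟩ := h2.dvd
    -- Cancelling u from a congruence modulo N = qu leaves one modulo q, so the residues 1 + Dk
    -- agree modulo Dq.
    have h3 : k w - k v = q * t := by
      have : (u : ℤ) ≠ 0 := by exact_mod_cast hu0
      apply mul_left_cancel₀ this
      push_cast at ht
      linarith
    have h4 : ((v : (ZMod (D * q))ˣ) : ZMod (D * q)) = ((w : (ZMod (D * q))ˣ) : ZMod (D * q)) := by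
      rw [← ZMod.natCast_zmod_val ((v : (ZMod (D * q))ˣ) : ZMod (D * q)),
        ← ZMod.natCast_zmod_val ((w : (ZMod (D * q))ˣ) : ZMod (D * q)),
        ZMod.natCast_eq_natCast_iff, ← Int.natCast_modEq_iff, hk v, hk w]
      refine Int.modEq_iff_dvd.2 ⟨t, ?_⟩
      push_cast
      linear_combination (D : ℤ) * h3
    exact Subtype.ext (Units.ext h4)
  have : Finite (MulAut G) := Finite.of_injective _ (DFunLike.coe_injective (F := MulAut G))
  have hcard : q.totient ≤ Nat.card A :=
    (ZMod.totient_le_card_ker_unitsMap hD0 hq0).trans (Nat.card_le_card_of_injective _ hinj)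
  calc e ≤ m * q := Nat.le_of_dvd (Nat.pos_of_ne_zero (mul_ne_zero hm0 hq0)) hemq
    _ ≤ m * (2 * Nat.card A ^ 2) := by
      gcongr
      exact (Nat.le_two_mul_totient_sq q).trans (by gcongr)

/-! ### Schur's bound and the order of G. -/

/-- The number of commutators is at most the square of the index of the centre. -/
theorem card_commutatorSet_le_index_center_sq (G : Type*) [Group G] [Finite G] :
    Nat.card (commutatorSet G) ≤ (center G).index ^ 2 := by
  -- A commutator depends only on the cosets of its entries modulo the centre.
  have hcomm : ∀ a b : G, ⁅((a : G ⧸ center G).out), ((b : G ⧸ center G).out)⁆ = ⁅a, b⁆ := by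
    intro a b
    obtain ⟨s, hs⟩ := QuotientGroup.mk_out_eq_mul (center G) a
    obtain ⟨t, ht⟩ := QuotientGroup.mk_out_eq_mul (center G) b
    rw [hs, ht]
    have h1 := fun g => mem_center_iff.1 s.2 g
    have h2 := fun g => mem_center_iff.1 t.2 g
    rw [commutatorElement_def, commutatorElement_def, mul_inv_rev, mul_inv_rev]
    calc a * s * (b * t) * ((s : G)⁻¹ * a⁻¹) * ((t : G)⁻¹ * b⁻¹)
        = a * (s * (b * t) * (s : G)⁻¹) * a⁻¹ * ((t : G)⁻¹ * b⁻¹) := by group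
      _ = a * b * (t * a⁻¹) * (t : G)⁻¹ * b⁻¹ := by rw [← h1]; group
      _ = a * b * a⁻¹ * b⁻¹ := by rw [← h2]; group
  let f : (G ⧸ center G) × (G ⧸ center G) → commutatorSet G := fun p =>
    ⟨⁅p.1.out, p.2.out⁆, commutator_mem_commutatorSet _ _⟩
  have hf : Function.Surjective f := by
    rintro ⟨_, a, b, rfl⟩
    exact ⟨(a, b), Subtype.ext (hcomm a b)⟩
  calc Nat.card (commutatorSet G) ≤ Nat.card ((G ⧸ center G) × (G ⧸ center G)) :=
        Nat.card_le_card_of_surjective f hf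
    _ = (center G).index ^ 2 := by rw [Nat.card_prod, sq]; rfl

/-- Schur's theorem with an explicit bound. -/
theorem card_commutator_le_index_center_pow (G : Type*) [Group G] [Finite G] :
    Nat.card (commutator G) ≤ (center G).index ^ ((center G).index ^ 3 + 1) := by
  have hpos : 0 < (center G).index := Nat.pos_of_ne_zero FiniteIndex.index_ne_zero
  refine (Nat.le_of_dvd (pow_pos hpos _) (card_commutator_dvd_index_center_pow G)).trans
    (Nat.pow_le_pow_right hpos ?_)
  have := Nat.mul_le_mul_left (center G).index (card_commutatorSet_le_index_center_sq G)
  rw [pow_succ' _ 2]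
  omega

/-- The order of a finite group, measured through a subgroup `H` and the exponent of the largest
abelian quotient in which `H` dies. -/
theorem card_le_commutator_mul_mul_exponent_pow {G : Type*} [Group G] [Finite G] (H : Subgroup G) :
    Nat.card G ≤ Nat.card (commutator G) * Nat.card H *
      Monoid.exponent (Abelianization G ⧸ H.map Abelianization.of) ^ Group.rank G := by
  have : Finite (Abelianization G) := Finite.of_surjective _ QuotientGroup.mk_surjective
  set B := Abelianization G ⧸ H.map Abelianization.of with hB
  let π : G →* B := (QuotientGroup.mk' (H.map Abelianization.of)).comp Abelianization.of
  have hπ : Function.Surjective π :=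
    (QuotientGroup.mk'_surjective _).comp QuotientGroup.mk_surjective
  have : Finite B := Finite.of_surjective π hπ
  have he : 0 < Monoid.exponent B := Nat.pos_of_ne_zero Monoid.exponent_ne_zero_of_finite
  have h1 : Nat.card G = Nat.card (Abelianization G) * Nat.card (commutator G) :=
    card_eq_card_quotient_mul_card_subgroup _
  have h2 : Nat.card (Abelianization G) =
      Nat.card B * Nat.card (H.map (Abelianization.of (G := G))) :=
    card_eq_card_quotient_mul_card_subgroup _
  have h3 : Nat.card (H.map (Abelianization.of (G := G))) ≤ Nat.card H :=
    Nat.card_le_card_of_surjective _ (MonoidHom.subgroupMap_surjective _ _)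
  have h4 : Nat.card B ≤ Monoid.exponent B ^ Group.rank G :=
    (Nat.le_of_dvd (pow_pos he _) (card_dvd_exponent_pow_rank B)).trans
      (Nat.pow_le_pow_right he (Group.rank_le_of_surjective π hπ))
  calc Nat.card G = Nat.card (commutator G) * Nat.card (H.map (Abelianization.of (G := G))) *
        Nat.card B := by rw [h1, h2]; ring
    _ ≤ _ := by gcongr

/-! ### Automorphisms induced by the normaliser. -/

namespace Equiv.Perm

variable {Ω : Type*} {G : Subgroup (Equiv.Perm Ω)}

/-- An automorphism of a transitive permutation group which fixes a point stabiliser pointwise is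
induced by the normaliser. -/
theorem mem_autPerm_of_fixes_stabilizer [MulAction.IsPretransitive G Ω] (ω : Ω) (α : MulAut G)
    (hα : ∀ h ∈ MulAction.stabilizer G ω, α h = h) : α ∈ autPerm G := by
  choose s hs using fun w => MulAction.exists_smul_eq G ω w
  -- This makes the map gω ↦ β(g)ω independent of the choice of g: two choices differ by an element
  -- of the stabiliser, which β fixes.
  have key : ∀ β : MulAut G, (∀ h ∈ MulAction.stabilizer G ω, β h = h) →
      ∀ g w, β (s (g • w)) • ω = β g • β (s w) • ω := by
    intro β hβ g w
    have hmem : (s (g • w))⁻¹ * (g * s w) ∈ MulAction.stabilizer G ω := by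
      rw [MulAction.mem_stabilizer_iff, mul_smul, mul_smul, hs, inv_smul_eq_iff, hs]
    have h := hβ _ hmem
    have h' := MulAction.mem_stabilizer_iff.1 hmem
    rw [← h, map_mul, map_inv, mul_smul, inv_smul_eq_iff, map_mul, mul_smul] at h'
    exact h'.symm
  have hα' : ∀ h ∈ MulAction.stabilizer G ω, α⁻¹ h = h := fun h hh => by
    rw [MulAut.inv_apply, MulEquiv.symm_apply_eq, hα h hh]
  have cancel : ∀ β : MulAut G, (∀ h ∈ MulAction.stabilizer G ω, β h = h) →
      (∀ h ∈ MulAction.stabilizer G ω, β⁻¹ h = h) →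
      ∀ w, β⁻¹ (s (β (s w) • ω)) • ω = w := by
    intro β hβ hβ' w
    have hsω : s ω ∈ MulAction.stabilizer G ω := hs ω
    rw [key _ hβ', MulAut.inv_apply_self, hβ' _ hsω, hs, hs]
  let σ : Equiv.Perm Ω :=
    { toFun := fun w => α (s w) • ω
      invFun := fun w => α⁻¹ (s w) • ω
      left_inv := cancel α hα hα'
      right_inv := fun w => by simpa using cancel α⁻¹ hα' (by simpa using hα) w }
  have hσ : ∀ g : G, σ * g * σ⁻¹ = α g := by
    intro g
    rw [mul_inv_eq_iff_eq_mul]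
    ext w
    exact key α hα g w
  have hσn : σ ∈ normalizer (G : Set (Equiv.Perm Ω)) := by
    rw [mem_normalizer_iff]
    refine fun g => ⟨fun hg => ?_, fun hg => ?_⟩
    · have := hσ ⟨g, hg⟩
      simp only at this
      rw [this]
      exact (α ⟨g, hg⟩).2
    · have := hσ (α.symm ⟨_, hg⟩)
      rw [MulEquiv.apply_symm_apply] at this
      have : ((α.symm ⟨_, hg⟩ : G) : Equiv.Perm Ω) = g :=
        mul_left_cancel (mul_right_cancel this)
      rw [← this]
      exact (α.symm ⟨_, hg⟩).2
  refine ⟨⟨σ, hσn⟩, ?_⟩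
  ext1 g
  exact Subtype.ext (hσ g)

/-- Inner automorphisms are induced by the normaliser. -/
theorem conj_range_le_autPerm : (MulAut.conj (G := G)).range ≤ autPerm G := by
  rintro _ ⟨g, rfl⟩
  exact ⟨⟨g, le_normalizer g.2⟩, by ext1 h; exact Subtype.ext rfl⟩

theorem index_center_le_card_autPerm [Finite G] :
    (center G).index ≤ Nat.card (autPerm G) := by
  have : Finite (MulAut G) := Finite.of_injective _ (DFunLike.coe_injective (F := MulAut G))
  have hker : (MulAut.conj (G := G)).ker = center G := by
    ext g
    rw [MonoidHom.mem_ker, mem_center_iff, MulEquiv.ext_iff]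
    refine forall_congr' fun h => ?_
    rw [MulAut.conj_apply, MulAut.one_apply, mul_inv_eq_iff_eq_mul, eq_comm]
  rw [← hker, index_ker]
  exact Subgroup.card_le_of_le conj_range_le_autPerm

/-- Point stabilisers of a transitive permutation group meet the centre trivially. -/
theorem card_stabilizer_le_index_center [Finite G] [MulAction.IsPretransitive G Ω] (ω : Ω) :
    Nat.card (MulAction.stabilizer G ω) ≤ (center G).index := by
  refine Nat.card_le_card_of_injective
    (fun h : MulAction.stabilizer G ω => ((h : G) : G ⧸ center G)) fun a b hab => ?_
  have hc : (a : G)⁻¹ * b ∈ center G := QuotientGroup.eq.1 hab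
  have hst : (a : G)⁻¹ * b ∈ MulAction.stabilizer G ω := mul_mem (inv_mem a.2) b.2
  -- A central element fixing ω fixes every gω.
  have hone : (a : G)⁻¹ * b = 1 := by
    apply Subtype.ext
    ext w
    obtain ⟨g, rfl⟩ := MulAction.exists_smul_eq G ω w
    change ((a : G)⁻¹ * b) • g • ω = g • ω
    rw [← mul_smul, ← mem_center_iff.1 hc g, mul_smul, MulAction.mem_stabilizer_iff.1 hst]
  exact Subtype.ext (inv_mul_eq_one.1 hone)

theorem card_le_of_isPretransitive [Finite G] [MulAction.IsPretransitive G Ω] (ω : Ω) :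
    Nat.card G ≤ Nat.card (autPerm G) ^ (Nat.card (autPerm G) ^ 3 + 1) * Nat.card (autPerm G) *
      (2 * Nat.card (autPerm G) ^ 3) ^ Group.rank G := by
  have hm := index_center_le_card_autPerm (G := G)
  have hm0 : 0 < (center G).index := Nat.pos_of_ne_zero FiniteIndex.index_ne_zero
  set n := Nat.card (autPerm G)
  have hn : 0 < n := hm0.trans_le hm
  have he := exponent_le_of_forall_mem_of_fixes (MulAction.stabilizer G ω) (autPerm G)
    (mem_autPerm_of_fixes_stabilizer ω)
  refine (card_le_commutator_mul_mul_exponent_pow (MulAction.stabilizer G ω)).trans ?_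
  gcongr
  · exact (card_commutator_le_index_center_pow G).trans
      ((Nat.pow_le_pow_left hm _).trans (Nat.pow_le_pow_right hn (by gcongr)))
  · exact (card_stabilizer_le_index_center ω).trans hm
  · refine he.trans ?_
    calc (center G).index * (2 * n ^ 2) ≤ n * (2 * n ^ 2) := by gcongr
      _ = 2 * n ^ 3 := by ring

end Equiv.Perm

/-! ### Comparison with the stated bound. -/

theorem le_orderBound {d n : ℕ} (hd : 1 ≤ d) (hn : 1 ≤ n) :
    ((n ^ (n ^ 3 + 1) * n * (2 * n ^ 3) ^ d : ℕ) : ℝ) ≤ orderBound d n := by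
  have hn' : (1 : ℝ) ≤ n := by exact_mod_cast hn
  have hd' : (1 : ℝ) ≤ d := by exact_mod_cast hd
  have hlog : 0 ≤ Real.logb 2 n := Real.logb_nonneg one_lt_two hn'
  have hsplit : ((n ^ (n ^ 3 + 1) * n * (2 * n ^ 3) ^ d : ℕ) : ℝ) =
      2 ^ d * (n : ℝ) ^ (((n ^ 3 + 2 + 3 * d : ℕ)) : ℝ) := by
    rw [Real.rpow_natCast]
    push_cast
    rw [mul_pow, ← pow_mul]
    ring
  rw [hsplit, orderBound]
  gcongr
  · calc (2 : ℝ) ^ d ≤ 16 ^ d := by gcongr; norm_num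
      _ ≤ 16 ^ ((n + 1) * d) := by
        gcongr
        · norm_num
        · nlinarith
  -- The first summand of the exponent is discarded. The rest suffices: n³ + 2 + 3d ≤ 2n³ + 4nd +
  -- 4d, the 2 being absorbed because nd ≥ 1.
  · have h1 : 0 ≤ 2 * (n : ℝ) ^ 3 * (d : ℝ) ^ 2 *
        (5 + (d : ℝ) + 4 * (n : ℝ) ^ 3 * Real.logb 2 n) := by positivity
    have h2 : (1 : ℝ) ≤ (n : ℝ) * d := one_le_mul_of_one_le_of_one_le hn' hd'
    have h3 : 0 ≤ (n : ℝ) ^ 3 := by positivity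
    push_cast
    linarith

theorem lemma5p3 {Ω : Type*} (G : Subgroup (Equiv.Perm Ω)) [Finite G]
    [MulAction.IsPretransitive G Ω] :
    (Nat.card G : ℝ) ≤ orderBound (Group.rank G) (Nat.card (Equiv.Perm.autPerm G)) := by
  have hn : 1 ≤ Nat.card (Equiv.Perm.autPerm G) :=
    (Nat.pos_of_ne_zero FiniteIndex.index_ne_zero).trans_le
      Equiv.Perm.index_center_le_card_autPerm
  -- For trivial G the set Ω may be empty and the rank is 0; otherwise there is a base point and the
  -- rank is at least 1.
  rcases subsingleton_or_nontrivial G with hG | hG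
  · have hn' : (1 : ℝ) ≤ Nat.card (Equiv.Perm.autPerm G) := by exact_mod_cast hn
    have hlog := Real.logb_nonneg one_lt_two hn'
    rw [Nat.card_of_subsingleton (1 : G), Nat.cast_one, orderBound]
    exact one_le_mul_of_one_le_of_one_le (one_le_pow₀ (by norm_num))
      (Real.one_le_rpow hn' (by positivity))
  · obtain ⟨g, hg⟩ := exists_ne (1 : G)
    obtain ⟨ω⟩ : Nonempty Ω := by
      by_contra hΩ
      rw [not_nonempty_iff] at hΩ
      exact hg (Subsingleton.elim _ _)
    have hd : 1 ≤ Group.rank G := by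
      by_contra h
      obtain ⟨S, hS, hclos⟩ := Group.rank_spec G
      have hS0 : S = ∅ := Finset.card_eq_zero.1 (by omega)
      rw [hS0, Finset.coe_empty, Subgroup.closure_empty] at hclos
      exact bot_ne_top hclos
    exact (Nat.cast_le.2 (Equiv.Perm.card_le_of_isPretransitive ω)).trans (le_orderBound hd hn)
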